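/- Let $n\ge 1$ and $\tau(n)=\left(1+\frac1n\right)(H_{n+1}-1)$, where $H_m=\sum_{k=1}^m \frac1k$. An instance $\mathcal I$ of size $n$ of online minimum bipartite matching under the uniform metric consists of two disjoint sets $L$ and $R$ of $n$ labelled points each and a (pseudo)metric $d$ on $L\cup R$ that takes only the values $0$ and $1$ (distinct points may be colocated). The points of $L$ are known in advance; the points of $R$ arrive one at a time in a uniformly random order. When $j\in R$ arrives, its distances to $L$ and to the points that arrived before are revealed, and an online algorithm must irrevocably match $j$ to a still unmatched $i\in L$ at cost $d(i,j)$. Its decisions depend only on what has been revealed so far and, if the algorithm is randomized, on its own randomness, which is independent of the arrival order. Let $\mathrm{ALG}(\mathcal I)$ be the expected total cost, over the random arrival order and the randomness of the algorithm, let $\mathrm{OPT}(\mathcal I)$ be the minimum cost of a perfect matching between $L$ and $R$, and let the competitive ratio of the algorithm on instances of size $n$ be $$\mathsf{CR}(\mathrm{ALG})=\sup_{\mathcal I}\frac{\mathrm{ALG}(\mathcal I)}{\mathrm{OPT}(\mathcal I)}\in[0,\infty],$$ the supremum being over all instances of size $n$, with the conventions $0/0=0$ and $a/0=\infty$ for $a>0$.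 Then every online algorithm, deterministic or randomized, satisfies $\mathsf{CR}(\mathrm{ALG})\ge\tau(n)$. -/

import Mathlib

open scoped BigOperators ENNReal

noncomputable section

namespace OnlineMatching

/-- An instance of size `n` of online minimum bipartite matching under the uniform metric.
The points of `L` (known in advance) are the `Sum.inl i`, those of `R` (arriving online) the
`Sum.inr j`. The distance is a (pseudo)metric on the disjoint union of `L` and `R` which takes
only the values `0` and `1`; distinct points may be colocated, that is, at distance `0`. -/
structure UniformInstance (n : ℕ) where
  d : Fin n ⊕ Fin n → Fin n ⊕ Fin n → ℝ
  d_self : ∀ x, d x x = 0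
  d_comm : ∀ x y, d x y = d y x
  d_triangle : ∀ x y z, d x z ≤ d x y + d y z
  d_binary : ∀ x y, d x y = 0 ∨ d x y = 1

/-- The points known to an algorithm in round `t` when the arrival order is `σ` (the point
arriving in round `s` is `σ s`): all of `L`, and the points of `R` that arrived up to and
including round `t`. -/
def knownPoints {n : ℕ} (σ : Equiv.Perm (Fin n)) (t : Fin n) : Set (Fin n ⊕ Fin n) :=
  {x | (∃ i, x = Sum.inl i) ∨ ∃ s, s ≤ t ∧ x = Sum.inr (σ s)}

/-- A deterministic online algorithm for instances of size `n`: `assign I σ t` is the point of `L`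
to which the point arriving in round `t` is matched. Each point of `L` is used at most once, and
the decision of round `t` depends only on what has been revealed: which points arrived in the
rounds `s ≤ t` and in which order, and the distances among all known points. -/
structure OnlineAlgorithm (n : ℕ) where
  assign : UniformInstance n → Equiv.Perm (Fin n) → Fin n → Fin n
  assign_injective : ∀ I σ, Function.Injective (assign I σ)
  online : ∀ (I I' : UniformInstance n) (σ σ' : Equiv.Perm (Fin n)) (t : Fin n),
    (∀ s, s ≤ t → σ s = σ' s) →
    (∀ x ∈ knownPoints σ t, ∀ y ∈ knownPoints σ t, I.d x y = I'.d x y) →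
    assign I σ t = assign I' σ' t

/-- Total cost of the matching produced on instance `I` with arrival order `σ`. -/
def OnlineAlgorithm.cost {n : ℕ} (D : OnlineAlgorithm n) (I : UniformInstance n)
    (σ : Equiv.Perm (Fin n)) : ℝ :=
  ∑ t, I.d (Sum.inl (D.assign I σ t)) (Sum.inr (σ t))

/-- Expected cost under random-order arrivals: the average over all arrival orders. -/
def OnlineAlgorithm.expectedCost {n : ℕ} (D : OnlineAlgorithm n) (I : UniformInstance n) : ℝ :=
  (∑ σ : Equiv.Perm (Fin n), D.cost I σ) / (Fintype.card (Equiv.Perm (Fin n)) : ℝ)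

/-- A randomized online algorithm with random seeds in `Ω`: a seed is drawn from the probability
measure `law`, independently of the arrival order, and fixes a deterministic online algorithm,
each decision being a measurable function of the seed. -/
structure RandomizedAlgorithm (n : ℕ) (Ω : Type*) [MeasurableSpace Ω] where
  law : MeasureTheory.Measure Ω
  isProbabilityMeasure_law : MeasureTheory.IsProbabilityMeasure law
  run : Ω → OnlineAlgorithm n
  measurable_run : ∀ I σ t, Measurable fun ω => (run ω).assign I σ t

/-- Expected cost of a randomized algorithm, over both its seed and the random arrival order. -/
def RandomizedAlgorithm.expectedCost {n : ℕ} {Ω : Type*} [MeasurableSpace Ω]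
    (A : RandomizedAlgorithm n Ω) (I : UniformInstance n) : ℝ :=
  ∫ ω, (A.run ω).expectedCost I ∂A.law

/-- Offline optimum: minimum cost of a perfect matching between `L` and `R`. It does not depend
on the arrival order. -/
def opt {n : ℕ} (I : UniformInstance n) : ℝ :=
  Finset.univ.inf' Finset.univ_nonempty
    fun π : Equiv.Perm (Fin n) => ∑ j, I.d (Sum.inl (π j)) (Sum.inr j)

/-- Competitive ratio, on instances of size `n`, of an algorithm with expected costs `c`: the
supremum over all instances of `c I / opt I` in `[0, ∞]`, where `0 / 0 = 0` and `a / 0 = ∞` for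
`a > 0`. -/
def competitiveRatio {n : ℕ} (c : UniformInstance n → ℝ) : ℝ≥0∞ :=
  ⨆ I : UniformInstance n, ENNReal.ofReal (c I) / ENNReal.ofReal (opt I)

/-- `τ(n) = (1 + 1/n) (H_{n+1} - 1)`. -/
def tau (n : ℕ) : ℝ := (1 + 1 / (n : ℝ)) * ((harmonic (n + 1) : ℝ) - 1)

end OnlineMatching

end

namespace OnlineMatching

/-! This is a Yao-type averaging argument over `hardInstance π k`, with `π` and `k` uniform. Every
such instance has optimum at most 1, so an average cost of at least `tau n` suffices. Fix the
arrival order `σ` and a round `t`, counted from 0. With probability `1/n` the outlier arrives now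
and costs 1. With probability `t/n` it came earlier. Then `n - t + 1` labels have undetermined,
exchangeable places (`k` included, as `π k` is never revealed), while `t` points of `L` are used.
Together these exceed `n`, so some undetermined place is already used, and the current request has
it with probability at least `1/(n - t + 1)` (`factorial_le_sum_cost_round`). Summing over `t` gives
`tau n` (`card_mul_tau`). -/

/-- Reciprocals of `n + 1, n, …, 2` sum to `H_{n+1} - 1`. -/
theorem sum_inv_eq_harmonic_sub_one (n : ℕ) :
    ∑ t : Fin n, ((n : ℝ) - (t : ℕ) + 1)⁻¹ = (harmonic (n + 1) : ℝ) - 1 := by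
  rw [harmonic, Finset.sum_range_succ', Fin.sum_univ_eq_sum_range
    (fun t : ℕ => ((n : ℝ) - t + 1)⁻¹) n, ← Finset.sum_range_reflect]
  push_cast
  have h : ∀ j ∈ Finset.range n,
      ((n : ℝ) - ((n - 1 - j : ℕ) : ℝ) + 1)⁻¹ = ((j : ℝ) + 1 + 1)⁻¹ := by
    intro j hj
    have hj := Finset.mem_range.mp hj
    have : (n - 1 - j : ℕ) = n - (j + 1) := by omega
    rw [this, Nat.cast_sub (by omega)]
    push_cast
    ring_nf
  rw [Finset.sum_congr rfl h]
  simp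

/-- The `n` collects the outlier's own cost in each round; the sum collects the `t` choices of an
earlier outlier. -/
theorem card_mul_tau {n : ℕ} (hn : 1 ≤ n) :
    (n : ℝ) * tau n = n + ∑ t : Fin n, ((t : ℕ) : ℝ) * ((n : ℝ) - (t : ℕ) + 1)⁻¹ := by
  have hterm : ∀ t : Fin n, ((t : ℕ) : ℝ) * ((n : ℝ) - (t : ℕ) + 1)⁻¹ =
      ((n : ℝ) + 1) * ((n : ℝ) - (t : ℕ) + 1)⁻¹ - 1 := by
    intro t
    have ht : ((t : ℕ) : ℝ) < n := by exact_mod_cast t.isLt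
    have : (n : ℝ) - (t : ℕ) + 1 ≠ 0 := by linarith
    field_simp
    ring
  have hn0 : (n : ℝ) ≠ 0 := by exact_mod_cast (by omega : n ≠ 0)
  simp_rw [hterm]
  rw [Finset.sum_sub_distrib, ← Finset.mul_sum, sum_inv_eq_harmonic_sub_one, tau]
  simp only [Finset.sum_const, Finset.card_univ, Fintype.card_fin, nsmul_eq_mul, mul_one]
  field_simp
  ring

/-- Locations of the points in the hard instances: the points of `L` occupy the `n` distinct
places `some i`, the request `k` sits at the extra place `none`, and every other request `j` is
colocated with `π j`. -/
def hardLoc {n : ℕ} (π : Equiv.Perm (Fin n)) (k : Fin n) : Fin n ⊕ Fin n → Option (Fin n)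
  | Sum.inl i => some i
  | Sum.inr j => if j = k then none else some (π j)

/-- The hard instance determined by a permutation `π` and the outlying request `k`. -/
def hardInstance {n : ℕ} (π : Equiv.Perm (Fin n)) (k : Fin n) : UniformInstance n where
  d x y := if hardLoc π k x = hardLoc π k y then 0 else 1
  d_self x := by simp
  d_comm x y := by simp only [eq_comm]
  d_triangle x y z := by
    by_cases hxy : hardLoc π k x = hardLoc π k y
    · simp [hxy]
    · simp only [hxy, if_false]
      split_ifs <;> norm_num
  d_binary x y := by split_ifs <;> simp

theorem UniformInstance.d_nonneg {n : ℕ} (I : UniformInstance n) (x y : Fin n ⊕ Fin n) :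
    0 ≤ I.d x y := by
  rcases I.d_binary x y with h | h <;> simp [h]

theorem UniformInstance.d_le_one {n : ℕ} (I : UniformInstance n) (x y : Fin n ⊕ Fin n) :
    I.d x y ≤ 1 := by
  rcases I.d_binary x y with h | h <;> simp [h]

theorem opt_hardInstance_le_one {n : ℕ} (π : Equiv.Perm (Fin n)) (k : Fin n) :
    opt (hardInstance π k) ≤ 1 := by
  refine (Finset.inf'_le _ (Finset.mem_univ π)).trans ?_
  rw [Finset.sum_eq_single k]
  · exact UniformInstance.d_le_one _ _ _
  · intro j _ hj
    simp [hardInstance, hardLoc, hj]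
  · simp

theorem hardInstance_d_outlier {n : ℕ} (π : Equiv.Perm (Fin n)) (k i : Fin n) :
    (hardInstance π k).d (Sum.inl i) (Sum.inr k) = 1 := by
  simp [hardInstance, hardLoc]

theorem hardInstance_d_eq_one {n : ℕ} (π : Equiv.Perm (Fin n)) {k i j : Fin n} (h : i ≠ π j) :
    (hardInstance π k).d (Sum.inl i) (Sum.inr j) = 1 := by
  by_cases hj : j = k <;> simp [hardInstance, hardLoc, hj, h]

/-- Permuting the places of the outlier and of the requests that arrive from round `t` on does
not affect what is revealed before round `t`. -/
theorem assign_hardInstance_swap {n : ℕ} (D : OnlineAlgorithm n) (π : Equiv.Perm (Fin n))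
    (σ : Equiv.Perm (Fin n)) {k t r : Fin n} {a b : Fin n} (hr : r < t)
    (ha : a = k ∨ t ≤ σ.symm a) (hb : b = k ∨ t ≤ σ.symm b) :
    D.assign (hardInstance (π * Equiv.swap a b) k) σ r = D.assign (hardInstance π k) σ r := by
  have hloc : ∀ x ∈ knownPoints σ r,
      hardLoc (π * Equiv.swap a b) k x = hardLoc π k x := by
    rintro x (⟨i, rfl⟩ | ⟨s, hs, rfl⟩)
    · rfl
    · by_cases hk : σ s = k
      -- The outlier sits at `none` whatever `π k` is, so `k` may take part in the swap even after
      -- its arrival.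
      · simp [hardLoc, hk]
      · have hne : ∀ c, (c = k ∨ t ≤ σ.symm c) → σ s ≠ c := by
          rintro c hc rfl
          rcases hc with hc | hc
          · exact hk hc
          · rw [Equiv.symm_apply_apply] at hc
            exact absurd (hc.trans hs) (not_le.mpr hr)
        simp [hardLoc, hk, Equiv.swap_apply_of_ne_of_ne (hne a ha) (hne b hb)]
  refine D.online _ _ σ σ r (fun _ _ => rfl) fun x hx y hy => ?_
  simp only [hardInstance, hloc x hx, hloc y hy]

/-- The labels whose place is still undetermined when round `t` begins, provided that the outlier
`k` has already arrived. -/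
def openLabels {n : ℕ} (σ : Equiv.Perm (Fin n)) (k t : Fin n) : Finset (Fin n) :=
  insert k ((Finset.Ici t).map σ.toEmbedding)

theorem mem_openLabels {n : ℕ} {σ : Equiv.Perm (Fin n)} {k t a : Fin n} :
    a ∈ openLabels σ k t ↔ a = k ∨ t ≤ σ.symm a := by
  simp [openLabels, Finset.mem_map_equiv]

theorem card_openLabels {n : ℕ} {σ : Equiv.Perm (Fin n)} {k t : Fin n} (hk : σ.symm k < t) :
    (openLabels σ k t).card = n - t + 1 := by
  rw [openLabels, Finset.card_insert_of_notMem]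
  · simp
  · simpa [Finset.mem_map_equiv] using hk

/-- Once the outlier has arrived, fewer points of `L` are free than there are open labels, so one
of the open labels leads to a cost if its place is requested in round `t`. -/
theorem exists_swap_cost_eq_one {n : ℕ} (D : OnlineAlgorithm n) (π σ : Equiv.Perm (Fin n))
    {k t : Fin n} (hk : σ.symm k < t) :
    ∃ s ∈ openLabels σ k t,
      (hardInstance (π * Equiv.swap (σ t) s) k).d
        (Sum.inl (D.assign (hardInstance (π * Equiv.swap (σ t) s) k) σ t)) (Sum.inr (σ t)) = 1 := by
  set used : Finset (Fin n) := (Finset.Iio t).image (D.assign (hardInstance π k) σ)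
  have hused : used.card = t := by
    rw [Finset.card_image_of_injective _ (D.assign_injective _ _)]
    simp
  have hmeet : ∃ s ∈ openLabels σ k t, π s ∈ used := by
    by_contra! hcon
    have hdisj : Disjoint ((openLabels σ k t).map π.toEmbedding) used := by
      rw [Finset.disjoint_left]
      intro x hx
      obtain ⟨s, hs, rfl⟩ := Finset.mem_map.mp hx
      exact hcon s hs
    -- Disjointness would fit `(n - t + 1) + t = n + 1` points into `Fin n`.
    have hcard := Finset.card_le_univ (((openLabels σ k t).map π.toEmbedding) ∪ used)
    rw [Finset.card_union_of_disjoint hdisj, Finset.card_map, card_openLabels hk, hused,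
      Fintype.card_fin] at hcard
    have := t.isLt
    omega
  obtain ⟨s, hs, hsu⟩ := hmeet
  obtain ⟨r, hr, hrs⟩ := Finset.mem_image.mp hsu
  have hr := Finset.mem_Iio.mp hr
  refine ⟨s, hs, hardInstance_d_eq_one _ fun heq => ?_⟩
  rw [Equiv.Perm.mul_apply, Equiv.swap_apply_left, ← hrs,
    ← assign_hardInstance_swap D π σ hr (Or.inr (σ.symm_apply_apply t).ge) (mem_openLabels.mp hs)] at heq
  exact hr.ne' (D.assign_injective _ _ heq)

/-- Double counting: each `π` has an open label whose swap with `σ t` forces cost 1, and each of the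
`n - t + 1` swaps merely permutes the sum over `π`. -/
theorem factorial_le_sum_cost_round {n : ℕ} (D : OnlineAlgorithm n) (σ : Equiv.Perm (Fin n))
    {k t : Fin n} (hk : σ.symm k < t) :
    (n.factorial : ℝ) * ((n : ℝ) - (t : ℕ) + 1)⁻¹ ≤ ∑ π : Equiv.Perm (Fin n),
      (hardInstance π k).d (Sum.inl (D.assign (hardInstance π k) σ t)) (Sum.inr (σ t)) := by
  set f : Equiv.Perm (Fin n) → ℝ := fun π =>
    (hardInstance π k).d (Sum.inl (D.assign (hardInstance π k) σ t)) (Sum.inr (σ t)) with hf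
  have hpos : (0 : ℝ) < (n : ℝ) - (t : ℕ) + 1 := by
    have : ((t : ℕ) : ℝ) < n := by exact_mod_cast t.isLt
    linarith
  have hswap : ∀ s, ∑ π, f (π * Equiv.swap (σ t) s) = ∑ π, f π := fun s =>
    Equiv.sum_comp (Equiv.mulRight (Equiv.swap (σ t) s)) f
  have hone : ∀ π, (1 : ℝ) ≤ ∑ s ∈ openLabels σ k t, f (π * Equiv.swap (σ t) s) := by
    intro π
    obtain ⟨s, hs, h1⟩ := exists_swap_cost_eq_one D π σ hk
    rw [← h1]
    exact Finset.single_le_sum (f := fun s => f (π * Equiv.swap (σ t) s))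
      (fun s _ => UniformInstance.d_nonneg _ _ _) hs
  have hsum : (n.factorial : ℝ) ≤ ((n : ℝ) - (t : ℕ) + 1) * ∑ π, f π := by
    calc (n.factorial : ℝ) = ∑ _π : Equiv.Perm (Fin n), (1 : ℝ) := by
          simp [Fintype.card_perm]
      _ ≤ ∑ π, ∑ s ∈ openLabels σ k t, f (π * Equiv.swap (σ t) s) :=
          Finset.sum_le_sum fun π _ => hone π
      _ = ((n : ℝ) - (t : ℕ) + 1) * ∑ π, f π := by
          rw [Finset.sum_comm]
          simp_rw [hswap]
          rw [Finset.sum_const, card_openLabels hk, nsmul_eq_mul]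
          push_cast [Nat.cast_sub t.isLt.le]
          ring
  rw [← div_eq_mul_inv, div_le_iff₀ hpos]
  linarith

theorem le_sum_cost_hardInstance {n : ℕ} (hn : 1 ≤ n) (D : OnlineAlgorithm n)
    (σ : Equiv.Perm (Fin n)) :
    (n.factorial : ℝ) * (n * tau n) ≤ ∑ k, ∑ π, D.cost (hardInstance π k) σ := by
  have hround : ∀ t : Fin n, (n.factorial : ℝ) * (1 + (t : ℕ) * ((n : ℝ) - (t : ℕ) + 1)⁻¹) ≤
      ∑ s : Fin n, ∑ π : Equiv.Perm (Fin n), (hardInstance π (σ s)).d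
        (Sum.inl (D.assign (hardInstance π (σ s)) σ t)) (Sum.inr (σ t)) := by
    intro t
    -- Outliers still to come (`s > t`) are bounded below by 0.
    have hIic : (∑ s ∈ Finset.Iic t, ∑ π : Equiv.Perm (Fin n), (hardInstance π (σ s)).d
        (Sum.inl (D.assign (hardInstance π (σ s)) σ t)) (Sum.inr (σ t))) ≤
      ∑ s : Fin n, ∑ π : Equiv.Perm (Fin n), (hardInstance π (σ s)).d
        (Sum.inl (D.assign (hardInstance π (σ s)) σ t)) (Sum.inr (σ t)) :=
      Finset.sum_le_univ_sum_of_nonneg fun s =>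
        Finset.sum_nonneg fun π _ => UniformInstance.d_nonneg _ _ _
    refine le_trans ?_ hIic
    rw [← Finset.Iio_insert, Finset.sum_insert (by simp)]
    simp_rw [hardInstance_d_outlier]
    have hlt : ∀ s ∈ Finset.Iio t, (n.factorial : ℝ) * ((n : ℝ) - (t : ℕ) + 1)⁻¹ ≤
        ∑ π : Equiv.Perm (Fin n), (hardInstance π (σ s)).d
          (Sum.inl (D.assign (hardInstance π (σ s)) σ t)) (Sum.inr (σ t)) := fun s hs =>
      factorial_le_sum_cost_round D σ (by simpa using hs)
    have := Finset.sum_le_sum hlt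
    simp only [Finset.sum_const, Fin.card_Iio, nsmul_eq_mul, Finset.card_univ,
      Fintype.card_perm, Fintype.card_fin, mul_one] at this ⊢
    linarith
  calc (n.factorial : ℝ) * (n * tau n)
      = ∑ t : Fin n, (n.factorial : ℝ) * (1 + (t : ℕ) * ((n : ℝ) - (t : ℕ) + 1)⁻¹) := by
        rw [card_mul_tau hn, ← Finset.mul_sum, Finset.sum_add_distrib]
        simp
    _ ≤ _ := Finset.sum_le_sum fun t _ => hround t
    _ = ∑ k, ∑ π, D.cost (hardInstance π k) σ := by
        rw [Finset.sum_comm, ← Equiv.sum_comp σ (fun k => ∑ π, D.cost (hardInstance π k) σ)]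
        refine Finset.sum_congr rfl fun s _ => ?_
        rw [Finset.sum_comm]
        rfl

theorem le_sum_expectedCost_hardInstance {n : ℕ} (hn : 1 ≤ n) (D : OnlineAlgorithm n) :
    (n.factorial : ℝ) * (n * tau n) ≤ ∑ k, ∑ π, D.expectedCost (hardInstance π k) := by
  simp only [OnlineAlgorithm.expectedCost]
  simp_rw [← Finset.sum_div]
  rw [le_div_iff₀ (by exact_mod_cast Fintype.card_pos)]
  calc _ = ∑ _σ : Equiv.Perm (Fin n), (n.factorial : ℝ) * (n * tau n) := by
        rw [Finset.sum_const, Finset.card_univ, nsmul_eq_mul, mul_comm]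
    _ ≤ ∑ σ, ∑ k, ∑ π, D.cost (hardInstance π k) σ :=
        Finset.sum_le_sum fun σ _ => le_sum_cost_hardInstance hn D σ
    _ = _ := by
        rw [Finset.sum_comm]
        exact Finset.sum_congr rfl fun k _ => Finset.sum_comm

theorem measurable_expectedCost {n : ℕ} {Ω : Type*} [MeasurableSpace Ω]
    (A : RandomizedAlgorithm n Ω) (I : UniformInstance n) :
    Measurable fun ω => (A.run ω).expectedCost I := by
  simp only [OnlineAlgorithm.expectedCost, OnlineAlgorithm.cost]
  refine Measurable.div_const (Finset.measurable_fun_sum _ fun σ _ =>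
    Finset.measurable_fun_sum _ fun t _ => ?_) _
  exact (measurable_of_finite fun i : Fin n => I.d (Sum.inl i) (Sum.inr (σ t))).comp
    (A.measurable_run I σ t)

theorem OnlineAlgorithm.expectedCost_nonneg {n : ℕ} (D : OnlineAlgorithm n)
    (I : UniformInstance n) : 0 ≤ D.expectedCost I :=
  div_nonneg (Finset.sum_nonneg fun _ _ => Finset.sum_nonneg fun _ _ => I.d_nonneg _ _)
    (Nat.cast_nonneg _)

theorem OnlineAlgorithm.expectedCost_le {n : ℕ} (D : OnlineAlgorithm n)
    (I : UniformInstance n) : D.expectedCost I ≤ n := by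
  rw [OnlineAlgorithm.expectedCost, div_le_iff₀ (by exact_mod_cast Fintype.card_pos)]
  calc ∑ σ, D.cost I σ ≤ ∑ _σ : Equiv.Perm (Fin n), ∑ _t : Fin n, (1 : ℝ) :=
        Finset.sum_le_sum fun _ _ => Finset.sum_le_sum fun _ _ => I.d_le_one _ _
    _ = _ := by simp [mul_comm]

theorem integrable_expectedCost {n : ℕ} {Ω : Type*} [MeasurableSpace Ω]
    (A : RandomizedAlgorithm n Ω) (I : UniformInstance n) :
    MeasureTheory.Integrable (fun ω => (A.run ω).expectedCost I) A.law := by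
  have := A.isProbabilityMeasure_law
  refine MeasureTheory.Integrable.of_bound (measurable_expectedCost A I).aestronglyMeasurable
    (n : ℝ) (Filter.Eventually.of_forall fun ω => ?_)
  rw [Real.norm_of_nonneg ((A.run ω).expectedCost_nonneg I)]
  exact (A.run ω).expectedCost_le I

/-- The deterministic bound holds for every seed, so it survives integration over the seed. -/
theorem le_sum_randomized_expectedCost {n : ℕ} (hn : 1 ≤ n) {Ω : Type*} [MeasurableSpace Ω]
    (A : RandomizedAlgorithm n Ω) :
    (n.factorial : ℝ) * (n * tau n) ≤ ∑ k, ∑ π, A.expectedCost (hardInstance π k) := by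
  have := A.isProbabilityMeasure_law
  have hint : ∀ k, MeasureTheory.Integrable
      (fun ω => ∑ π, (A.run ω).expectedCost (hardInstance π k)) A.law := fun k =>
    MeasureTheory.integrable_finsetSum _ fun π _ => integrable_expectedCost A _
  calc (n.factorial : ℝ) * (n * tau n)
      = ∫ _ω, (n.factorial : ℝ) * (n * tau n) ∂A.law := by simp
    _ ≤ ∫ ω, ∑ k, ∑ π, (A.run ω).expectedCost (hardInstance π k) ∂A.law :=
        MeasureTheory.integral_mono (MeasureTheory.integrable_const _)
          (MeasureTheory.integrable_finsetSum _ fun k _ => hint k)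
          fun ω => le_sum_expectedCost_hardInstance hn (A.run ω)
    _ = ∑ k, ∑ π, A.expectedCost (hardInstance π k) := by
        rw [MeasureTheory.integral_finsetSum _ fun k _ => hint k]
        refine Finset.sum_congr rfl fun k _ => ?_
        rw [MeasureTheory.integral_finsetSum _ fun π _ => integrable_expectedCost A _]
        rfl

/-- Averaging over the hard instances: each has optimum at most one. -/
theorem tau_le_competitiveRatio {n : ℕ} (hn : 1 ≤ n) (c : UniformInstance n → ℝ)
    (h : (n.factorial : ℝ) * (n * tau n) ≤ ∑ k, ∑ π, c (hardInstance π k)) :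
    ENNReal.ofReal (tau n) ≤ competitiveRatio c := by
  obtain ⟨k, π, hk⟩ : ∃ k π, tau n ≤ c (hardInstance π k) := by
    by_contra! hcon
    have : Nonempty (Fin n) := ⟨⟨0, hn⟩⟩
    have hlt : ∑ k, ∑ π, c (hardInstance π k) <
        ∑ _k : Fin n, ∑ _π : Equiv.Perm (Fin n), tau n :=
      Finset.sum_lt_sum_of_nonempty Finset.univ_nonempty fun k _ =>
        Finset.sum_lt_sum_of_nonempty Finset.univ_nonempty fun π _ => hcon k π
    simp only [Finset.sum_const, Finset.card_univ, Fintype.card_perm, Fintype.card_fin,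
      nsmul_eq_mul] at hlt
    linarith
  calc ENNReal.ofReal (tau n) ≤ ENNReal.ofReal (c (hardInstance π k)) :=
        ENNReal.ofReal_le_ofReal hk
    _ = ENNReal.ofReal (c (hardInstance π k)) / 1 := by rw [div_one]
    _ ≤ ENNReal.ofReal (c (hardInstance π k)) / ENNReal.ofReal (opt (hardInstance π k)) :=
        ENNReal.div_le_div_left
          (ENNReal.ofReal_le_one.mpr (opt_hardInstance_le_one π k)) _
    _ ≤ competitiveRatio c := le_iSup
        (fun I => ENNReal.ofReal (c I) / ENNReal.ofReal (opt I)) (hardInstance π k)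

end OnlineMatching

theorem theorem2 (n : ℕ) (hn : 1 ≤ n) :
    (∀ D : OnlineMatching.OnlineAlgorithm n,
      ENNReal.ofReal (OnlineMatching.tau n) ≤
        OnlineMatching.competitiveRatio D.expectedCost) ∧
    (∀ (Ω : Type*) [MeasurableSpace Ω] (A : OnlineMatching.RandomizedAlgorithm n Ω),
      ENNReal.ofReal (OnlineMatching.tau n) ≤
        OnlineMatching.competitiveRatio A.expectedCost) :=
  ⟨fun D => OnlineMatching.tau_le_competitiveRatio hn _
      (OnlineMatching.le_sum_expectedCost_hardInstance hn D),
    fun _ _ A => OnlineMatching.tau_le_competitiveRatio hn _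
      (OnlineMatching.le_sum_randomized_expectedCost hn A)⟩
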